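/- Let $d\ge 3$ and $R>0$, and let $\partial B(0,R)\subset\mathbb{R}^d$ be the sphere of radius $R$ centred at the origin. For $\omega,\omega_*\in\partial B(0,R)$ let $$\Big(\mathbb{S}^{d-2}\perp\tfrac{\omega+\omega_*}{2}\Big)=\Big\{\sigma\in\mathbb{R}^d : |\sigma|=1,\ \tfrac{\omega+\omega_*}{2}\cdot\sigma=0\Big\},$$ equipped with its natural surface measure $d\sigma$ (the case $\omega+\omega_*=0$ concerns only a null set of pairs), and let $d\omega$, $d\omega_*$ be the surface measure of $\partial B(0,R)$. On the bundle $$\mathcal{B}=\Big\{(\omega,\omega_*,\sigma) : \omega,\omega_*\in\partial B(0,R),\ \sigma\in\Big(\mathbb{S}^{d-2}\perp\tfrac{\omega+\omega_*}{2}\Big)\Big\}$$ consider the measure $d\omega\,d\omega_*\,d\sigma$, and set $$\omega'=\frac{\omega+\omega_*}{2}+\frac{|\omega-\omega_*|}{2}\sigma,\qquad \omega_*'=\frac{\omega+\omega_*}{2}-\frac{|\omega-\omega_*|}{2}\sigma .$$ Then $\omega',\omega_*'\in\partial B(0,R)$ for all $(\omega,\omega_*,\sigma)\in\mathcal{B}$.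 The pre-post-collisional map $$(\omega,\omega_*,\sigma)\mapsto\Big(\omega',\omega_*',\frac{\omega-\omega_*}{|\omega-\omega_*|}\Big),$$ defined for $\omega\ne\omega_*$ (hence almost everywhere on $\mathcal{B}$), takes values in $\mathcal{B}$ and preserves the measure $d\omega\,d\omega_*\,d\sigma$. Moreover, for every continuous $\chi:\partial B(0,R)^4\to\mathbb{R}$, both integrands below are integrable and $$\int_{\mathcal{B}}\chi(\omega,\omega_*,\omega',\omega_*')\,d\omega\,d\omega_*\,d\sigma=\int_{\mathcal{B}}\chi(\omega',\omega_*',\omega,\omega_*)\,d\omega\,d\omega_*\,d\sigma .$$ -/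

import Mathlib

open MeasureTheory ProbabilityTheory Metric

noncomputable section

/-- The natural surface measure on the sphere of radius `R` centred at the origin of a
finite-dimensional Euclidean space `F`, seen as a measure on `F`: the image of the surface measure
of the unit sphere under `x ↦ R • x`, multiplied by `R ^ (dim F - 1)`. -/
def sphereSurface (F : Type*) [NormedAddCommGroup F] [InnerProductSpace ℝ F]
    [FiniteDimensional ℝ F] [MeasurableSpace F] [BorelSpace F] (R : ℝ) : Measure F :=
  ENNReal.ofReal (R ^ (Module.finrank ℝ F - 1)) •
    ((volume : Measure F).toSphere.map (fun x : sphere (0 : F) 1 => R • (x : F)))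

/-- The natural surface measure of the unit sphere `{σ : |σ| = 1, p · σ = 0}` of the orthogonal
complement of `p`, seen as a measure on the whole space. -/
def perpSphereSurface {E : Type*} [NormedAddCommGroup E] [InnerProductSpace ℝ E]
    [FiniteDimensional ℝ E] [MeasurableSpace E] [BorelSpace E] (p : E) : Measure E :=
  (sphereSurface (Submodule.span ℝ {p})ᗮ 1).map Subtype.val

instance sphereSurface_isFinite (F : Type*) [NormedAddCommGroup F] [InnerProductSpace ℝ F]
    [FiniteDimensional ℝ F] [MeasurableSpace F] [BorelSpace F] (R : ℝ) :
    IsFiniteMeasure (sphereSurface F R) := by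
  unfold sphereSurface
  exact Measure.smul_finite _ ENNReal.ofReal_ne_top

theorem sphereSurface_one_apply (F : Type*) [NormedAddCommGroup F] [InnerProductSpace ℝ F]
    [FiniteDimensional ℝ F] [MeasurableSpace F] [BorelSpace F] {s : Set F}
    (hs : MeasurableSet s) :
    sphereSurface F 1 s = Module.finrank ℝ F *
      volume (Set.image2 (fun (t : ℝ) (x : F) => t • x) (Set.Ioo 0 1) (s ∩ sphere 0 1)) := by
  have h1 : (fun x : sphere (0 : F) 1 => (1 : ℝ) • (x : F)) = Subtype.val := by
    funext x; simp
  rw [sphereSurface, h1, Measure.smul_apply, Measure.map_apply measurable_subtype_coe hs,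
    Measure.toSphere_apply' _ (measurable_subtype_coe hs), Subtype.image_preimage_coe,
    Set.inter_comm]
  simp only [one_pow, ENNReal.ofReal_one, one_smul]
  rfl

theorem sphereSurface_one_map {F G : Type*}
    [NormedAddCommGroup F] [InnerProductSpace ℝ F] [FiniteDimensional ℝ F]
    [MeasurableSpace F] [BorelSpace F]
    [NormedAddCommGroup G] [InnerProductSpace ℝ G] [FiniteDimensional ℝ G]
    [MeasurableSpace G] [BorelSpace G] (L : F ≃ₗᵢ[ℝ] G) :
    (sphereSurface F 1).map L = sphereSurface G 1 := by
  ext s hs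
  have hL : Measurable L := L.continuous.measurable
  rw [Measure.map_apply hL hs, sphereSurface_one_apply F (hL hs), sphereSurface_one_apply G hs,
    L.toLinearEquiv.finrank_eq]
  congr 1
  rw [← (L.measurePreserving).measure_preimage_emb L.toHomeomorph.measurableEmbedding]
  congr 1
  ext x
  simp only [Set.mem_image2, Set.mem_inter_iff, Set.mem_preimage, mem_sphere_zero_iff_norm]
  constructor
  · rintro ⟨t, ht, y, ⟨hy, hn⟩, rfl⟩
    exact ⟨t, ht, L y, ⟨hy, by simpa using hn⟩, by simp⟩
  · rintro ⟨t, ht, y, ⟨hy, hn⟩, h⟩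
    refine ⟨t, ht, L.symm y, ⟨by simpa using hy, by simpa using hn⟩, ?_⟩
    apply L.injective
    simpa using h

/-- A linear isometry of the whole space carries the unit sphere orthogonal to `p` to the
unit sphere orthogonal to its image, together with the surface measures. -/
theorem perpSphereSurface_map {E : Type*} [NormedAddCommGroup E] [InnerProductSpace ℝ E]
    [FiniteDimensional ℝ E] [MeasurableSpace E] [BorelSpace E] (L : E ≃ₗᵢ[ℝ] E) (p q : E)
    (h : (Submodule.span ℝ {q})ᗮ = (Submodule.span ℝ {p})ᗮ.map L.toLinearEquiv.toLinearMap) :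
    (perpSphereSurface p).map L = perpSphereSurface q := by
  have hm : ∀ x : (Submodule.span ℝ {p})ᗮ, L x ∈ (Submodule.span ℝ {q})ᗮ := fun x => by
    rw [h]
    exact Submodule.mem_map_of_mem x.2
  let M : (Submodule.span ℝ {p})ᗮ →ₗᵢ[ℝ] (Submodule.span ℝ {q})ᗮ :=
    { toLinearMap := (L.toLinearEquiv.toLinearMap.comp (Submodule.subtype _)).codRestrict _ hm
      norm_map' := fun x => L.norm_map x }
  have hs : Function.Surjective M := fun y => by
    obtain ⟨y, hy⟩ := y
    have hy' := hy
    rw [h] at hy'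
    obtain ⟨x, hx, hxy⟩ := hy'
    exact ⟨⟨x, hx⟩, Subtype.ext hxy⟩
  unfold perpSphereSurface
  rw [← sphereSurface_one_map (LinearIsometryEquiv.ofSurjective M hs),
    Measure.map_map L.continuous.measurable measurable_subtype_coe,
    Measure.map_map measurable_subtype_coe (LinearIsometryEquiv.continuous _).measurable]
  rfl

instance perpSphereSurface_isFinite {E : Type*} [NormedAddCommGroup E] [InnerProductSpace ℝ E]
    [FiniteDimensional ℝ E] [MeasurableSpace E] [BorelSpace E] (p : E) :
    IsFiniteMeasure (perpSphereSurface p) := by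
  unfold perpSphereSurface
  infer_instance

/-- For a unit vector `e`, the surface measure orthogonal to `p ≠ 0` is the image of the one
orthogonal to `e` under a reflection that takes `e` to `p / |p|`. -/
theorem perpSphereSurface_eq_map {E : Type*} [NormedAddCommGroup E] [InnerProductSpace ℝ E]
    [FiniteDimensional ℝ E] [MeasurableSpace E] [BorelSpace E] {e : E} (he : ‖e‖ = 1) {p : E}
    (hp : p ≠ 0) :
    perpSphereSurface p =
      (perpSphereSurface e).map (Submodule.span ℝ {e - ‖p‖⁻¹ • p})ᗮ.reflection := by
  refine (perpSphereSurface_map _ e p ?_).symm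
  have hp' : ‖p‖ ≠ 0 := norm_ne_zero_iff.mpr hp
  have hUe : (Submodule.span ℝ {e - ‖p‖⁻¹ • p})ᗮ.reflection e = ‖p‖⁻¹ • p := by
    apply Submodule.reflection_sub
    rw [he, norm_smul, norm_inv, norm_norm, inv_mul_cancel₀ hp']
  rw [Submodule.map_orthogonal_equiv, Submodule.map_span, Set.image_singleton]
  congr 1
  have : (Submodule.span ℝ {e - ‖p‖⁻¹ • p})ᗮ.reflection.toLinearEquiv.toLinearMap e =
    ‖p‖⁻¹ • p := hUe
  rw [this]
  exact (Submodule.span_singleton_smul_eq (IsUnit.mk0 _ (inv_ne_zero hp')) p).symm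

theorem perpSphereSurface_measurable {E : Type*} [NormedAddCommGroup E] [InnerProductSpace ℝ E]
    [FiniteDimensional ℝ E] [MeasurableSpace E] [BorelSpace E] :
    Measurable (perpSphereSurface : E → Measure E) := by
  classical
  rcases subsingleton_or_nontrivial E with hE | hE
  · exact measurable_from_top.mono (fun s _ => Subsingleton.measurableSet) le_rfl
  obtain ⟨e, he⟩ := exists_norm_eq E zero_le_one
  let w : E → E := fun p => e - ‖p‖⁻¹ • p
  let U : E → E ≃ₗᵢ[ℝ] E := fun p => (Submodule.span ℝ {w p})ᗮ.reflection
  have hU : Measurable (fun z : E × E => U z.1 z.2) := by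
    have : (fun z : E × E => U z.1 z.2) = fun z =>
        z.2 - (2 * (inner ℝ (w z.1) z.2 / (‖w z.1‖ ^ 2))) • w z.1 := by
      funext z
      simp only [U, Submodule.reflection_orthogonal_apply, Submodule.reflection_singleton_apply]
      simp [mul_smul, two_smul]
    rw [this]
    have hw : Measurable w := by fun_prop
    fun_prop
  have hpw : (perpSphereSurface : E → Measure E) =
      fun p => Set.piecewise {(0 : E)} (fun _ => perpSphereSurface (0 : E))
        (fun p => (perpSphereSurface e).map (U p)) p := by
    funext p
    by_cases hp : p = 0
    · simp [hp]
    · simp [hp, perpSphereSurface_eq_map he hp, U, w]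
  rw [hpw]
  refine Measurable.piecewise (measurableSet_singleton _) measurable_const ?_
  refine Measure.measurable_of_measurable_coe _ fun s hs => ?_
  have : (fun p => (perpSphereSurface e).map (U p) s) = fun p =>
      perpSphereSurface e (Prod.mk p ⁻¹' ((fun z : E × E => U z.1 z.2) ⁻¹' s)) := by
    funext p
    rw [Measure.map_apply (U p).continuous.measurable hs]
    rfl
  rw [this]
  exact measurable_measure_prodMk_left (hU hs)

/-- The family, indexed by `(ω, ω_*)`, of the surface measures of the unit spheres orthogonal to
`(ω + ω_*) / 2`. -/
def collisionKernel (d : ℕ) :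
    Kernel (EuclideanSpace ℝ (Fin d) × EuclideanSpace ℝ (Fin d)) (EuclideanSpace ℝ (Fin d)) where
  toFun z := perpSphereSurface ((2 : ℝ)⁻¹ • (z.1 + z.2))
  measurable' := perpSphereSurface_measurable.comp (by fun_prop)

instance collisionKernel_isFinite (d : ℕ) : IsFiniteKernel (collisionKernel d) := by
  have bound : ∃ C : ENNReal, C < ⊤ ∧
      ∀ p : EuclideanSpace ℝ (Fin d), perpSphereSurface p Set.univ ≤ C := by
    rcases subsingleton_or_nontrivial (EuclideanSpace ℝ (Fin d)) with hE | hE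
    · exact ⟨_, measure_lt_top (perpSphereSurface (0 : EuclideanSpace ℝ (Fin d))) Set.univ,
        fun p => by rw [Subsingleton.elim p 0]⟩
    obtain ⟨e, he⟩ := exists_norm_eq (EuclideanSpace ℝ (Fin d)) zero_le_one
    refine ⟨_, max_lt (measure_lt_top (perpSphereSurface (0 : EuclideanSpace ℝ (Fin d))) Set.univ)
      (measure_lt_top (perpSphereSurface e) Set.univ), fun p => ?_⟩
    by_cases hp : p = 0
    · rw [hp]
      exact le_max_left _ _
    · rw [perpSphereSurface_eq_map he hp,
        Measure.map_apply (LinearIsometryEquiv.continuous _).measurable MeasurableSet.univ,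
        Set.preimage_univ]
      exact le_max_right _ _
  obtain ⟨C, hC, h⟩ := bound
  exact ⟨C, hC, fun z => h _⟩

/-- The bundle `∂B(0,R) × ∂B(0,R) × (S^{d-2} ⟂ (ω + ω_*) / 2)`, whose points are
written `((ω, ω_*), σ)`. -/
def collisionBundle (d : ℕ) (R : ℝ) :
    Set ((EuclideanSpace ℝ (Fin d) × EuclideanSpace ℝ (Fin d)) × EuclideanSpace ℝ (Fin d)) :=
  {z | z.1.1 ∈ sphere 0 R ∧ z.1.2 ∈ sphere 0 R ∧
    ‖z.2‖ = 1 ∧ inner ℝ ((2 : ℝ)⁻¹ • (z.1.1 + z.1.2)) z.2 = 0}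

/-- The natural measure `dω dω_* dσ` on the collision bundle, that is
`A ↦ ∫_{∂B(0,R)} ∫_{∂B(0,R)} ∫_{S^{d-2} ⟂ (ω + ω_*) / 2} 1_A(ω, ω_*, σ) dσ dω_* dω`. -/
def collisionMeasure (d : ℕ) (R : ℝ) :
    Measure ((EuclideanSpace ℝ (Fin d) × EuclideanSpace ℝ (Fin d)) × EuclideanSpace ℝ (Fin d)) :=
  ((sphereSurface (EuclideanSpace ℝ (Fin d)) R).prod
    (sphereSurface (EuclideanSpace ℝ (Fin d)) R)).compProd (collisionKernel d)

/-- `ω' = (ω + ω_*) / 2 + (|ω - ω_*| / 2) σ`. -/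
def postVel {d : ℕ} (ω ω₁ σ : EuclideanSpace ℝ (Fin d)) : EuclideanSpace ℝ (Fin d) :=
  (2 : ℝ)⁻¹ • (ω + ω₁) + (‖ω - ω₁‖ / 2) • σ

/-- `ω_*' = (ω + ω_*) / 2 - (|ω - ω_*| / 2) σ`. -/
def postVelStar {d : ℕ} (ω ω₁ σ : EuclideanSpace ℝ (Fin d)) : EuclideanSpace ℝ (Fin d) :=
  (2 : ℝ)⁻¹ • (ω + ω₁) - (‖ω - ω₁‖ / 2) • σ

/-- The pre-post-collisional map `(ω, ω_*, σ) ↦ (ω', ω_*', (ω - ω_*) / |ω - ω_*|)`. On the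
diagonal `ω = ω_*`, where the last component is undefined, it takes the value `0` here. -/
def prePost {d : ℕ}
    (z : (EuclideanSpace ℝ (Fin d) × EuclideanSpace ℝ (Fin d)) × EuclideanSpace ℝ (Fin d)) :
    (EuclideanSpace ℝ (Fin d) × EuclideanSpace ℝ (Fin d)) × EuclideanSpace ℝ (Fin d) :=
  ((postVel z.1.1 z.1.2 z.2, postVelStar z.1.1 z.1.2 z.2), ‖z.1.1 - z.1.2‖⁻¹ • (z.1.1 - z.1.2))

end

/-!
Write `p = (ω + ω_*) / 2`, `n = (ω - ω_*) / |ω - ω_*|`. On the bundle, `n` and `σ` are unit vectors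
orthogonal to `p`, and the pre-post-collisional map exchanges them, keeping `p` and `|ω - ω_*|`.
The reflection in the hyperplane orthogonal to `n - σ` fixes `p` and exchanges `n` and `σ`, so
applied to all three components it takes `(ω, ω_*, σ)` to its image under the map. Hence the map
moves every point of the bundle off the diagonal inside its orbit under the diagonal action of the
orthogonal group (`prePost_mem_orbit`); in particular it maps the bundle to itself.

The reflection depends on the point, but the map commutes with the action of the orthogonal group
(`prePost_smul`), and the measure `dω dω_* dσ` is invariant under it
(`smulInvariant_collisionMeasure`). Averaging over the orthogonal group, which is compact, with its
Haar measure shows that such a map preserves the measure (`measurePreserving_of_mem_orbit`); no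
Jacobian is computed. The integral identity follows by composing the integrand with the map, whose
velocity components are involutive (`postVel_prePost`); the diagonal `ω = ω_*` is null because the
surface measure has no atoms.
-/

/-- A measurable map which commutes with the action of a compact group and moves almost every point
inside its orbit preserves every invariant measure. If `T x = ρ • x`, the set of those `g` with
`g⁻¹ • T x ∈ A` is a left translate of the set of those with `g⁻¹ • x ∈ A`, so both have the same
Haar measure, although `ρ` depends on `x`; integrating over `x` gives the claim. -/
theorem measurePreserving_of_mem_orbit {G X : Type*} [Group G] [TopologicalSpace G]
    [IsTopologicalGroup G] [CompactSpace G] [MeasurableSpace G] [BorelSpace G]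
    [SecondCountableTopology G]
    [MeasurableSpace X] [MulAction G X] [MeasurableSMul₂ G X] (μ : Measure X) [SFinite μ]
    [SMulInvariantMeasure G X μ] {T : X → X} (hT : Measurable T)
    (hequiv : ∀ (g : G) x, T (g • x) = g • T x) (horb : ∀ᵐ x ∂μ, T x ∈ MulAction.orbit G x) :
    MeasurePreserving T μ μ := by
  refine ⟨hT, Measure.ext fun A hA => ?_⟩
  rw [Measure.map_apply hT hA]
  let ν : Measure G := Measure.haar
  -- Tonelli's theorem for the product of the Haar measure with `μ`
  have avg : ∀ B : Set X, MeasurableSet B →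
      ν Set.univ * μ B = ∫⁻ x, ν {g | g⁻¹ • x ∈ B} ∂μ := fun B hB => by
    have hm : MeasurableSet {z : G × X | z.1⁻¹ • z.2 ∈ B} :=
      (measurable_fst.inv.smul measurable_snd) hB
    have h1 := Measure.prod_apply (μ := ν) (ν := μ) hm
    have h2 := Measure.prod_apply_symm (μ := ν) (ν := μ) hm
    have h3 : ∀ g : G, μ (Prod.mk g ⁻¹' {z : G × X | z.1⁻¹ • z.2 ∈ B}) = μ B := fun g =>
      measure_preimage_smul μ g⁻¹ B
    simp only [h3, lintegral_const] at h1
    rw [mul_comm, ← h1, h2]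
    rfl
  have key : ν Set.univ * μ (T ⁻¹' A) = ν Set.univ * μ A := by
    rw [avg _ (hT hA), avg _ hA]
    refine lintegral_congr_ae ?_
    filter_upwards [horb] with x hx
    obtain ⟨ρ, hρ⟩ := hx
    have : {g : G | g⁻¹ • x ∈ T ⁻¹' A} = (fun g => ρ⁻¹ * g) ⁻¹' {g | g⁻¹ • x ∈ A} := by
      ext g
      simp only [Set.mem_ofPred_eq, Set.mem_preimage, hequiv, mul_inv_rev, inv_inv, mul_smul]
      rw [← hρ]
    rw [this, measure_preimage_mul]
  exact (ENNReal.mul_right_inj (NeZero.ne _) (measure_ne_top _ _)).1 key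

/-! ### The compact group of orthogonal operators -/

/-- The orthogonal group `O(E)`, as the unitary elements of the star monoid of continuous linear
operators; it carries the topology of the operator norm. -/
abbrev OrthogonalOperator (E : Type*) [NormedAddCommGroup E] [InnerProductSpace ℝ E]
    [FiniteDimensional ℝ E] : Type _ :=
  unitary (E →L[ℝ] E)

section
variable {E : Type*} [NormedAddCommGroup E] [InnerProductSpace ℝ E] [FiniteDimensional ℝ E]

instance compactSpace_orthogonalOperator : CompactSpace (OrthogonalOperator E) := by
  have : ProperSpace (E →L[ℝ] E) := FiniteDimensional.proper ℝ _
  refine isCompact_iff_compactSpace.1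
    (Metric.isCompact_of_isClosed_isBounded isClosed_unitary ?_)
  refine isBounded_iff_forall_norm_le.2 ⟨1, fun u hu => ?_⟩
  refine ContinuousLinearMap.opNorm_le_bound _ zero_le_one fun x => ?_
  rw [one_mul]
  exact (Unitary.norm_map ⟨u, hu⟩ x).le

instance continuousSMul_orthogonalOperator : ContinuousSMul (OrthogonalOperator E) E :=
  ⟨isBoundedBilinearMap_apply.continuous.comp
    ((continuous_subtype_val.comp continuous_fst).prodMk continuous_snd)⟩

end

/-! ### Surface measures of spheres -/

section
variable {E : Type*} [NormedAddCommGroup E] [InnerProductSpace ℝ E] [FiniteDimensional ℝ E]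
  [MeasurableSpace E] [BorelSpace E]

theorem sphereSurface_eq_smul_map (R : ℝ) :
    sphereSurface E R = ENNReal.ofReal (R ^ (Module.finrank ℝ E - 1)) •
      (sphereSurface E 1).map (fun x => R • x) := by
  unfold sphereSurface
  rw [one_pow, ENNReal.ofReal_one, one_smul, Measure.map_map (by fun_prop) (by fun_prop)]
  congr 2
  funext x
  simp

theorem sphereSurface_map (L : E ≃ₗᵢ[ℝ] E) (R : ℝ) :
    (sphereSurface E R).map L = sphereSurface E R := by
  have hL : Measurable L := L.continuous.measurable
  have hR : Measurable fun x : E => R • x := by fun_prop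
  rw [sphereSurface_eq_smul_map, Measure.map_smul, Measure.map_map hL hR]
  conv_rhs => rw [← sphereSurface_one_map L, Measure.map_map hR hL]
  congr 2
  funext x
  simp

theorem sphereSurface_ae_mem_sphere {R : ℝ} (hR : 0 ≤ R) :
    ∀ᵐ x ∂sphereSurface E R, x ∈ sphere (0 : E) R := by
  refine Measure.ae_smul_measure ?_ _
  refine (ae_map_iff (p := (· ∈ sphere (0 : E) R)) (by fun_prop)
    isClosed_sphere.measurableSet).2 (.of_forall fun x => ?_)
  simp [norm_smul, abs_of_nonneg hR]

/-- In dimension at least two, points are null for the surface measure: the cone over a point lies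
in a line. -/
theorem nullSingletonClass_sphereSurface (hE : 2 ≤ Module.finrank ℝ E) {R : ℝ} (hR : R ≠ 0) :
    NullSingletonClass (sphereSurface E R) := by
  have h1 : ∀ y : E, sphereSurface E 1 {y} = 0 := fun y => by
    rw [sphereSurface_one_apply E (measurableSet_singleton y), mul_eq_zero]
    right
    have hsub : Set.image2 (fun (t : ℝ) (x : E) => t • x) (Set.Ioo 0 1) ({y} ∩ sphere 0 1) ⊆
        (Submodule.span ℝ {y} : Submodule ℝ E) := by
      rintro _ ⟨t, -, x, ⟨rfl, -⟩, rfl⟩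
      exact Submodule.smul_mem _ _ (Submodule.mem_span_singleton_self _)
    refine measure_mono_null hsub (Measure.addHaar_submodule _ _ fun h => ?_)
    have := finrank_span_le_card (R := ℝ) {y}
    rw [h, finrank_top, Set.toFinset_singleton, Finset.card_singleton] at this
    omega
  refine ⟨fun x => ?_⟩
  have hpre : (fun y : E => R • y) ⁻¹' {x} = {R⁻¹ • x} := by
    ext y
    simp [eq_inv_smul_iff₀ hR]
  rw [sphereSurface_eq_smul_map, Measure.smul_apply,
    Measure.map_apply (by fun_prop) (measurableSet_singleton x), hpre, h1, smul_zero]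

theorem perpSphereSurface_map_apply (L : E ≃ₗᵢ[ℝ] E) (p : E) :
    (perpSphereSurface p).map L = perpSphereSurface (L p) := by
  refine perpSphereSurface_map L p (L p) ?_
  rw [Submodule.map_orthogonal_equiv, Submodule.map_span, Set.image_singleton]
  rfl

theorem perpSphereSurface_ae_norm_inner (p : E) :
    ∀ᵐ x ∂perpSphereSurface p, ‖x‖ = 1 ∧ inner ℝ p x = 0 := by
  have hm : MeasurableSet {x : E | ‖x‖ = 1 ∧ inner ℝ p x = 0} :=
    (measurableSet_eq_fun (by fun_prop) (by fun_prop)).inter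
      (measurableSet_eq_fun (by fun_prop) (by fun_prop))
  rw [perpSphereSurface, ae_map_iff (by fun_prop) hm]
  filter_upwards [sphereSurface_ae_mem_sphere zero_le_one] with x hx
  exact ⟨by simpa using hx, Submodule.mem_orthogonal_singleton_iff_inner_right.1 x.2⟩
end

/-! ### The collision bundle and its measure -/

/-- The ambient space of the collision bundle, with points `((ω, ω_*), σ)`. -/
abbrev CollisionTriple (d : ℕ) : Type :=
  (EuclideanSpace ℝ (Fin d) × EuclideanSpace ℝ (Fin d)) × EuclideanSpace ℝ (Fin d)

section
variable {d : ℕ}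

theorem isClosed_collisionBundle (d : ℕ) (R : ℝ) : IsClosed (collisionBundle d R) := by
  have h1 : IsClosed {z : CollisionTriple d | z.1.1 ∈ sphere 0 R} :=
    isClosed_sphere.preimage (by fun_prop)
  have h2 : IsClosed {z : CollisionTriple d | z.1.2 ∈ sphere 0 R} :=
    isClosed_sphere.preimage (by fun_prop)
  exact h1.inter <| h2.inter <| (isClosed_eq (by fun_prop) (by fun_prop)).inter
    (isClosed_eq (by fun_prop) (by fun_prop))

theorem isCompact_collisionBundle (d : ℕ) (R : ℝ) : IsCompact (collisionBundle d R) := by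
  refine (((isCompact_sphere 0 R).prod (isCompact_sphere 0 R)).prod
    (isCompact_sphere 0 1)).of_isClosed_subset (isClosed_collisionBundle d R) ?_
  rintro z ⟨h1, h2, h3, -⟩
  exact ⟨⟨h1, h2⟩, by simpa using h3⟩

instance isFiniteMeasure_collisionMeasure (d : ℕ) (R : ℝ) :
    IsFiniteMeasure (collisionMeasure d R) := by
  unfold collisionMeasure
  infer_instance

theorem collisionMeasure_ae_mem_collisionBundle {R : ℝ} (hR : 0 ≤ R) :
    ∀ᵐ z ∂collisionMeasure d R, z ∈ collisionBundle d R := by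
  rw [collisionMeasure, Measure.ae_compProd_iff (p := (· ∈ collisionBundle d R))
    (isClosed_collisionBundle d R).measurableSet]
  have hS := sphereSurface_ae_mem_sphere (E := EuclideanSpace ℝ (Fin d)) hR
  have h1 : ∀ᵐ z ∂(sphereSurface (EuclideanSpace ℝ (Fin d)) R).prod
      (sphereSurface (EuclideanSpace ℝ (Fin d)) R), z.1 ∈ sphere 0 R :=
    Measure.quasiMeasurePreserving_fst.ae hS
  have h2 : ∀ᵐ z ∂(sphereSurface (EuclideanSpace ℝ (Fin d)) R).prod
      (sphereSurface (EuclideanSpace ℝ (Fin d)) R), z.2 ∈ sphere 0 R :=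
    Measure.quasiMeasurePreserving_snd.ae hS
  filter_upwards [h1, h2] with z hz1 hz2
  filter_upwards [perpSphereSurface_ae_norm_inner ((2 : ℝ)⁻¹ • (z.1 + z.2))] with σ hσ
  exact ⟨hz1, hz2, hσ.1, hσ.2⟩

theorem collisionMeasure_ae_ne (hd : 2 ≤ d) {R : ℝ} (hR : R ≠ 0) :
    ∀ᵐ z ∂collisionMeasure d R, z.1.1 ≠ z.1.2 := by
  have := nullSingletonClass_sphereSurface (E := EuclideanSpace ℝ (Fin d)) (by simpa using hd) hR
  have hm : MeasurableSet {z : EuclideanSpace ℝ (Fin d) × EuclideanSpace ℝ (Fin d) |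
      z.1 ≠ z.2} := (measurableSet_eq_fun measurable_fst measurable_snd).compl
  have hm' : MeasurableSet {z : CollisionTriple d | z.1.1 ≠ z.1.2} := measurable_fst hm
  rw [collisionMeasure, Measure.ae_compProd_iff hm']
  have h : ∀ᵐ z ∂(sphereSurface (EuclideanSpace ℝ (Fin d)) R).prod
      (sphereSurface (EuclideanSpace ℝ (Fin d)) R), z.1 ≠ z.2 := by
    rw [Measure.ae_prod_iff_ae_ae hm]
    refine .of_forall fun x => ?_
    filter_upwards [compl_mem_ae_iff.2 (measure_singleton x)] with y hy h
    exact hy h.symm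
  filter_upwards [h] with z hz
  exact .of_forall fun _ => hz

/-- The measure of the bundle is invariant under the diagonal action of the orthogonal group: this
holds for `dω dω_*`, and an orthogonal operator carries the surface measure orthogonal to
`ω + ω_*` to the one orthogonal to the image of `ω + ω_*`. -/
instance smulInvariant_collisionMeasure (d : ℕ) (R : ℝ) : SMulInvariantMeasure
    (OrthogonalOperator (EuclideanSpace ℝ (Fin d))) (CollisionTriple d) (collisionMeasure d R) := by
  refine ⟨fun u A hA => ?_⟩
  let L := Unitary.linearIsometryEquiv u
  have hL : Measurable L := L.continuous.measurable
  have hS := sphereSurface_map L R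
  have hSS : MeasurePreserving (Prod.map L L)
      ((sphereSurface (EuclideanSpace ℝ (Fin d)) R).prod (sphereSurface _ R))
      ((sphereSurface (EuclideanSpace ℝ (Fin d)) R).prod (sphereSurface _ R)) :=
    MeasurePreserving.prod ⟨hL, hS⟩ ⟨hL, hS⟩
  have hA' : MeasurableSet ((fun z => u • z) ⁻¹' A) := measurable_const_smul u hA
  rw [collisionMeasure, Measure.compProd_apply hA, Measure.compProd_apply hA',
    ← hSS.lintegral_comp (Kernel.measurable_kernel_prodMk_left hA)]
  refine lintegral_congr fun z => ?_
  have hk : collisionKernel d (Prod.map L L z) = (collisionKernel d z).map L := by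
    change perpSphereSurface _ = (perpSphereSurface _).map L
    rw [perpSphereSurface_map_apply]
    simp
  rw [hk, Measure.map_apply hL (measurable_prodMk_left hA)]
  rfl

/-! ### The pre-post-collisional map -/

theorem measurable_prePost : Measurable (prePost (d := d)) := by
  unfold prePost postVel postVelStar
  fun_prop

theorem prePost_smul (u : OrthogonalOperator (EuclideanSpace ℝ (Fin d)))
    (z : CollisionTriple d) : prePost (u • z) = u • prePost z := by
  obtain ⟨⟨x, y⟩, s⟩ := z
  have hn : ‖u • x - u • y‖ = ‖x - y‖ :=
    (Unitary.linearIsometryEquiv u).norm_map (x - y) ▸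
      congrArg norm (map_sub (Unitary.linearIsometryEquiv u) x y).symm
  have hact : ∀ v : EuclideanSpace ℝ (Fin d), u • v = Unitary.linearIsometryEquiv u v :=
    fun _ => rfl
  simp only [prePost, postVel, postVelStar, Prod.smul_mk, hn]
  simp only [hact, map_add, map_sub, map_smul]

/-- With `p = (ω + ω_*) / 2` and `n = (ω - ω_*) / |ω - ω_*|`, the pre-post-collisional map keeps `p`
and `|ω - ω_*|` and exchanges the unit vectors `n` and `σ`. As both are orthogonal to `p`, the
reflection in the hyperplane orthogonal to `n - σ` does the same. -/
theorem prePost_mem_orbit {R : ℝ} {z : CollisionTriple d}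
    (hz : z ∈ collisionBundle d R) (hne : z.1.1 ≠ z.1.2) :
    prePost z ∈ MulAction.orbit (OrthogonalOperator (EuclideanSpace ℝ (Fin d))) z := by
  obtain ⟨⟨x, y⟩, s⟩ := z
  obtain ⟨hx, hy, hs, hps⟩ := hz
  simp only [mem_sphere_zero_iff_norm] at hx hy hs hps hne
  have hr : ‖x - y‖ ≠ 0 := norm_ne_zero_iff.2 (sub_ne_zero.2 hne)
  set p := (2 : ℝ)⁻¹ • (x + y) with hp
  set n := ‖x - y‖⁻¹ • (x - y) with hn
  have hn1 : ‖n‖ = 1 := by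
    rw [hn, norm_smul, norm_inv, norm_norm, inv_mul_cancel₀ hr]
  have hpn : inner ℝ p n = 0 := by
    rw [hp, hn, inner_smul_left, inner_smul_right,
      (real_inner_add_sub_eq_zero_iff x y).2 (hx.trans hy.symm)]
    simp
  have hxy : ‖x - y‖ • n = x - y := by rw [hn, smul_inv_smul₀ hr]
  have hxp : x = p + (‖x - y‖ / 2) • n := by
    rw [div_eq_inv_mul, mul_smul, hxy, hp]; module
  have hyp : y = p - (‖x - y‖ / 2) • n := by
    rw [div_eq_inv_mul, mul_smul, hxy, hp]; module
  -- if `n = s`, this is the identity, which is what is needed then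
  let ρ := (Submodule.span ℝ {n - s})ᗮ.reflection
  have hρn : ρ n = s := Submodule.reflection_sub (hn1.trans hs.symm)
  have hρs : ρ s = n := by rw [← hρn]; exact Submodule.reflection_reflection _ _
  have hρp : ρ p = p := Submodule.reflection_mem_subspace_eq_self
    (Submodule.mem_orthogonal_singleton_iff_inner_left.2
      (by rw [inner_sub_right, hpn, hps, sub_zero]))
  refine ⟨Unitary.linearIsometryEquiv.symm ρ, ?_⟩
  change ((ρ x, ρ y), ρ s) = ((p + (‖x - y‖ / 2) • s, p - (‖x - y‖ / 2) • s), n)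
  have h1 : ρ x = p + (‖x - y‖ / 2) • s := by
    conv_lhs => rw [hxp]
    rw [map_add, hρp, map_smul, hρn]
  have h2 : ρ y = p - (‖x - y‖ / 2) • s := by
    conv_lhs => rw [hyp]
    rw [map_sub, hρp, map_smul, hρn]
  rw [h1, h2, hρs]

theorem smul_mem_collisionBundle {R : ℝ}
    (u : OrthogonalOperator (EuclideanSpace ℝ (Fin d)))
    {z : CollisionTriple d}
    (hz : z ∈ collisionBundle d R) : u • z ∈ collisionBundle d R := by
  obtain ⟨⟨x, y⟩, s⟩ := z
  obtain ⟨hx, hy, hs, hps⟩ := hz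
  let L := Unitary.linearIsometryEquiv u
  simp only [mem_sphere_zero_iff_norm] at hx hy hs hps
  change L x ∈ sphere 0 R ∧ L y ∈ sphere 0 R ∧ ‖L s‖ = 1 ∧
    inner ℝ ((2 : ℝ)⁻¹ • (L x + L y)) (L s) = 0
  rw [← map_add, ← map_smul, L.inner_map_map, mem_sphere_zero_iff_norm, mem_sphere_zero_iff_norm,
    L.norm_map, L.norm_map, L.norm_map]
  exact ⟨hx, hy, hs, hps⟩

theorem prePost_mem_collisionBundle {R : ℝ} {z : CollisionTriple d}
    (hz : z ∈ collisionBundle d R) (hne : z.1.1 ≠ z.1.2) : prePost z ∈ collisionBundle d R := by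
  obtain ⟨u, hu⟩ := prePost_mem_orbit hz hne
  rw [← hu]
  exact smul_mem_collisionBundle u hz

theorem postVel_mem_sphere {R : ℝ} {z : CollisionTriple d}
    (hz : z ∈ collisionBundle d R) :
    postVel z.1.1 z.1.2 z.2 ∈ sphere (0 : EuclideanSpace ℝ (Fin d)) R ∧
      postVelStar z.1.1 z.1.2 z.2 ∈ sphere (0 : EuclideanSpace ℝ (Fin d)) R := by
  by_cases hne : z.1.1 = z.1.2
  · have h : (2 : ℝ)⁻¹ • (z.1.2 + z.1.2) = z.1.2 := by module
    simpa [postVel, postVelStar, hne, h] using hz.2.1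
  · have h := prePost_mem_collisionBundle hz hne
    exact ⟨h.1, h.2.1⟩

/-- The pre-post-collisional map is an involution off the diagonal, as far as the two velocities are
concerned. -/
theorem postVel_prePost {z : CollisionTriple d} (hs : ‖z.2‖ = 1) (hne : z.1.1 ≠ z.1.2) :
    postVel (prePost z).1.1 (prePost z).1.2 (prePost z).2 = z.1.1 ∧
      postVelStar (prePost z).1.1 (prePost z).1.2 (prePost z).2 = z.1.2 := by
  obtain ⟨⟨x, y⟩, s⟩ := z
  simp only at hs hne
  have hr : ‖x - y‖ ≠ 0 := norm_ne_zero_iff.2 (sub_ne_zero.2 hne)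
  have hsum : postVel x y s + postVelStar x y s = x + y := by
    unfold postVel postVelStar; module
  have hdiff : ‖postVel x y s - postVelStar x y s‖ = ‖x - y‖ := by
    have : postVel x y s - postVelStar x y s = ‖x - y‖ • s := by
      unfold postVel postVelStar; module
    rw [this, norm_smul, norm_norm, hs, mul_one]
  have hn : (‖x - y‖ / 2) • ‖x - y‖⁻¹ • (x - y) = (2 : ℝ)⁻¹ • (x - y) := by
    rw [smul_smul]
    congr 1
    field_simp
  constructor
  · change (2 : ℝ)⁻¹ • (postVel x y s + postVelStar x y s) +
      (‖postVel x y s - postVelStar x y s‖ / 2) • ‖x - y‖⁻¹ • (x - y) = x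
    rw [hsum, hdiff, hn]
    module
  · change (2 : ℝ)⁻¹ • (postVel x y s + postVelStar x y s) -
      (‖postVel x y s - postVelStar x y s‖ / 2) • ‖x - y‖⁻¹ • (x - y) = y
    rw [hsum, hdiff, hn]
    module

theorem measurePreserving_prePost (hd : 2 ≤ d) {R : ℝ} (hR : 0 < R) :
    MeasurePreserving prePost (collisionMeasure d R) (collisionMeasure d R) := by
  refine measurePreserving_of_mem_orbit
    (G := OrthogonalOperator (EuclideanSpace ℝ (Fin d)))
    _ measurable_prePost prePost_smul ?_
  filter_upwards [collisionMeasure_ae_mem_collisionBundle hR.le,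
    collisionMeasure_ae_ne hd hR.ne'] with z hz hne
  exact prePost_mem_orbit hz hne

/-- The bundle is compact and carries the whole of the finite measure, so continuity on the bundle
is enough, whatever the function is elsewhere. -/
theorem integrable_of_continuousOn_collisionBundle {R : ℝ} (hR : 0 ≤ R)
    {f : CollisionTriple d → ℝ}
    (hf : ContinuousOn f (collisionBundle d R)) : Integrable f (collisionMeasure d R) := by
  have h : IntegrableOn f (collisionBundle d R) (collisionMeasure d R) :=
    hf.integrableOn_compact (isCompact_collisionBundle d R)
  rwa [IntegrableOn, Measure.restrict_eq_self_of_ae_mem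
    (collisionMeasure_ae_mem_collisionBundle hR)] at h
end

theorem mainTheorem7 (d : ℕ) (hd : 3 ≤ d) (R : ℝ) (hR : 0 < R) :
    -- the post-collisional velocities stay on the sphere
    (∀ z ∈ collisionBundle d R,
      postVel z.1.1 z.1.2 z.2 ∈ sphere (0 : EuclideanSpace ℝ (Fin d)) R ∧
      postVelStar z.1.1 z.1.2 z.2 ∈ sphere (0 : EuclideanSpace ℝ (Fin d)) R) ∧
    -- the bundle is invariant under the map, off the diagonal
    (∀ z ∈ collisionBundle d R, z.1.1 ≠ z.1.2 → prePost z ∈ collisionBundle d R) ∧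
    -- the map preserves the measure of the bundle
    MeasurePreserving prePost (collisionMeasure d R) (collisionMeasure d R) ∧
    -- the integral identity, for all continuous functions on the fourth power of the sphere
    (∀ χ : EuclideanSpace ℝ (Fin d) × EuclideanSpace ℝ (Fin d) ×
        EuclideanSpace ℝ (Fin d) × EuclideanSpace ℝ (Fin d) → ℝ,
      ContinuousOn χ (sphere 0 R ×ˢ sphere 0 R ×ˢ sphere 0 R ×ˢ sphere 0 R) →
      Integrable (fun z => χ (z.1.1, z.1.2, postVel z.1.1 z.1.2 z.2, postVelStar z.1.1 z.1.2 z.2))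
        (collisionMeasure d R) ∧
      Integrable (fun z => χ (postVel z.1.1 z.1.2 z.2, postVelStar z.1.1 z.1.2 z.2, z.1.1, z.1.2))
        (collisionMeasure d R) ∧
      ∫ z, χ (z.1.1, z.1.2, postVel z.1.1 z.1.2 z.2, postVelStar z.1.1 z.1.2 z.2)
          ∂(collisionMeasure d R) =
        ∫ z, χ (postVel z.1.1 z.1.2 z.2, postVelStar z.1.1 z.1.2 z.2, z.1.1, z.1.2)
          ∂(collisionMeasure d R)) := by
  have hcont : Continuous fun z : (EuclideanSpace ℝ (Fin d) × EuclideanSpace ℝ (Fin d)) ×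
      EuclideanSpace ℝ (Fin d) => postVel z.1.1 z.1.2 z.2 := by
    unfold postVel; fun_prop
  have hcontStar : Continuous fun z : (EuclideanSpace ℝ (Fin d) × EuclideanSpace ℝ (Fin d)) ×
      EuclideanSpace ℝ (Fin d) => postVelStar z.1.1 z.1.2 z.2 := by
    unfold postVelStar; fun_prop
  have hT := measurePreserving_prePost (d := d) (by omega) hR
  refine ⟨fun z hz => postVel_mem_sphere hz, fun z hz => prePost_mem_collisionBundle hz, hT,
    fun χ hχ => ?_⟩
  have hint : Integrable
      (fun z => χ (z.1.1, z.1.2, postVel z.1.1 z.1.2 z.2, postVelStar z.1.1 z.1.2 z.2))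
      (collisionMeasure d R) := by
    refine integrable_of_continuousOn_collisionBundle hR.le (hχ.comp (by fun_prop) fun z hz => ?_)
    have h := postVel_mem_sphere hz
    exact ⟨hz.1, hz.2.1, h.1, h.2⟩
  refine ⟨hint, ?_, ?_⟩
  · refine integrable_of_continuousOn_collisionBundle hR.le (hχ.comp (by fun_prop) fun z hz => ?_)
    have h := postVel_mem_sphere hz
    exact ⟨h.1, h.2, hz.1, hz.2.1⟩
  · -- the second integrand is almost everywhere the first one composed with `prePost`
    have hmap := integral_map hT.aemeasurable
      (hT.map_eq.symm ▸ hint.aestronglyMeasurable)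
    rw [hT.map_eq] at hmap
    refine hmap.trans (integral_congr_ae ?_)
    filter_upwards [collisionMeasure_ae_mem_collisionBundle hR.le,
      collisionMeasure_ae_ne (by omega) hR.ne'] with z hz hne
    obtain ⟨h1, h2⟩ := postVel_prePost hz.2.2.1 hne
    simp only [h1, h2]
    rfl
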